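/- Let $K$ be a field and let $l,m,s,t$ be non-negative integers with $m=tl+s$, $0\le s<l$ and $t\ge 2$. A run of length $r\ge 1$ is a simplicial complex on $(r-1)l+m$ distinct vertices $x_1,\dots,x_{(r-1)l+m}$ whose facets are the $r$ sets $F_i=\{x_{(i-1)l+1},\dots,x_{(i-1)l+m}\}$, $1\le i\le r$. Let $\alpha,\beta\ge 0$ be integers with $\alpha+\beta\ge 1$, let $p_1,\dots,p_\alpha,q_1,\dots,q_\beta\ge 0$ be integers, and put $P=\sum_{a=1}^{\alpha}p_a$ and $Q=\sum_{b=1}^{\beta}q_b$. Let $\Gamma$ be a disjoint union (with pairwise disjoint vertex sets) of runs of lengths $p_1(t+1)+1,\dots,p_\alpha(t+1)+1,\ q_1(t+1)+2,\dots,q_\beta(t+1)+2$; for instance, an induced subcollection, whose connected components are runs of these lengths, of the path complex with facets $\{x_{(i-1)l+1},\dots,x_{(i-1)l+m}\}$, $1\le i\le n/l$ (indices modulo $n$), of a cycle with $n$ vertices $x_1,\dots,x_n$, where $l\mid n$. Let $V(\Gamma)$ be the vertex set of $\Gamma$ and let $\mathcal E$ be the simplicial complex generated by the sets $V(\Gamma)\setminus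 F$, where $F$ runs over the facets of $\Gamma$. Then for every integer $i$ the reduced simplicial homology of $\mathcal E$ with coefficients in $K$ is $$\widetilde H_i(\mathcal E)\cong\begin{cases}K,&\text{if } i=2(P+Q)+2\beta+\alpha-2,\\ 0,&\text{otherwise.}\end{cases}$$ -/

import Mathlib

set_option maxSynthPendingDepth 3

namespace PathComplexes

/-- An abstract simplicial complex with vertices in `V`: a collection of finite sets closed under
taking subsets. The empty face is allowed, so that the complex `{∅}` differs from the complex
without faces. -/
@[ext]
structure SimplicialComplex (V : Type*) where
  faces : Set (Finset V)
  down_closed : ∀ ⦃F G : Finset V⦄, F ∈ faces → G ⊆ F → G ∈ faces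

namespace SimplicialComplex

variable {V : Type*}

/-- The facets: the maximal faces under inclusion. -/
def facets (D : SimplicialComplex V) : Set (Finset V) := {F | Maximal (fun G => G ∈ D.faces) F}

/-- The vertex set `V(Δ)`. -/
def vertexSet (D : SimplicialComplex V) : Set V := {v | {v} ∈ D.faces}

/-- `⟨F | F ∈ S⟩`: the complex whose faces are the finite subsets of the members of `S`. -/
def generated (S : Set (Set V)) : SimplicialComplex V where
  faces := {G | ∃ F ∈ S, (G : Set V) ⊆ F}
  down_closed := by
    rintro F G ⟨H, hH, hF⟩ hG
    exact ⟨H, hH, fun _ hx => hF (hG hx)⟩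

/-- The complement `Δ_Y^c = ⟨Y \ F | F a facet of Δ⟩`. -/
def complement (D : SimplicialComplex V) (Y : Set V) : SimplicialComplex V :=
  generated {G | ∃ F ∈ D.facets, G = Y \ (F : Set V)}

section Homology

variable (K : Type*) [Field K] [LinearOrder V]

/-- The simplicial boundary map for the orientation given by the order of the vertices,
`∂ σ = ∑_{v ∈ σ} (-1)^{#{w ∈ σ | w < v}} (σ \ {v})`; in particular `∂ {v} = ∅` (the augmentation)
and `∂ ∅ = 0`. -/
noncomputable def boundary : (Finset V →₀ K) →ₗ[K] (Finset V →₀ K) :=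
  Finsupp.lsum K fun σ => LinearMap.toSpanSingleton K (Finset V →₀ K)
    (∑ v ∈ σ, Finsupp.single (σ.erase v) ((-1 : K) ^ (σ.filter (fun w => w < v)).card))

/-- The reduced `i`-chains: combinations of the faces with `i + 1` elements (`i = -1` gives the
empty face, and there are no chains in degrees below `-1`). -/
def chains (D : SimplicialComplex V) (i : ℤ) : Submodule K (Finset V →₀ K) :=
  Finsupp.supported K K {σ | σ ∈ D.faces ∧ (σ.card : ℤ) = i + 1}

/-- The reduced `i`-cycles `Z_i`. -/
noncomputable def cycles (D : SimplicialComplex V) (i : ℤ) : Submodule K (Finset V →₀ K) :=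
  D.chains K i ⊓ LinearMap.ker (boundary K)

/-- The reduced `i`-boundaries `B_i`. -/
noncomputable def boundaries (D : SimplicialComplex V) (i : ℤ) : Submodule K (Finset V →₀ K) :=
  (D.chains K (i + 1)).map (boundary K)

/-- The reduced homology `Z_i / B_i` with coefficients in `K`. -/
abbrev ReducedHomology (D : SimplicialComplex V) (i : ℤ) : Type _ :=
  D.cycles K i ⧸ (D.boundaries K i).submoduleOf (D.cycles K i)

end Homology

/-- The path complex `Δ_{m,l}` of the line graph with `p` facets
`{x_{al}, …, x_{al + m - 1}}`, `0 ≤ a < p`, on the vertices `x_0, x_1, …`; here `x_v` is `v`. -/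
def line (m l p : ℕ) : SimplicialComplex ℕ :=
  generated {G | ∃ a < p, G = Set.Ico (a * l) (a * l + m)}

/-- `R` is a run of length `p`: it is a copy of the path complex of a line with `p` facets, under
a labelling `x` of its vertices without repetitions. -/
def IsRun (m l p : ℕ) (R : SimplicialComplex V) : Prop :=
  ∃ x : ℕ → V, Set.InjOn x (line m l p).vertexSet ∧
    ∀ G : Finset V, G ∈ R.faces ↔ ∃ F ∈ (line m l p).faces, (G : Set V) = x '' (F : Set ℕ)

/-- `D` is the disjoint union of runs of lengths `s j`. -/
def IsDisjointUnionOfRuns (m l : ℕ) {ι : Type*} (s : ι → ℕ) (D : SimplicialComplex V) : Prop :=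
  ∃ R : ι → SimplicialComplex V, (∀ j, IsRun m l (s j) (R j)) ∧
    (Pairwise fun j k => Disjoint (R j).vertexSet (R k).vertexSet) ∧
    D.faces = ⋃ j, (R j).faces

end SimplicialComplex

end PathComplexes

/-! The faces of $\mathcal E$ are the subsets of $V(\Gamma)$ that miss some facet of $\Gamma$, so
only the incidence between a point set $W$ and a family $A$ of blocks matters. Two moves on it
control the homology.

Domination: if every block through $v$ contains $w$, the link of $w$ is a cone with apex $v$, so $w$
can be deleted (`TransversalConcentrated.of_erase_dominating`). Forcing: if some block meets $W$ in
$v$ alone, every subset of $W\setminus\{v\}$ misses that block. The deletion of $v$ is then a full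
simplex, and the homology is that of the link of $v$, one degree lower, where the link keeps the
blocks not through $v$ (`TransversalConcentrated.of_forced`).

`Collapses` records a reduction to nothing by these moves and counts the forced choices. With $N\ge
1$ of them the homology is $K$ in dimension $N-2$ and zero elsewhere. Moves in one run do not affect
the others, so the counts add.

In a run it is enough to keep the vertices $jl+s$; the blocks become the integer intervals $[i,i+t)$
(`run_of_range`). Two forced choices remove the ends, and two more remove each stretch of $t+1$
blocks (`range_of_interior`, `interior_step`). The counts are $2p+1$ and $2q+2$ for lengths
$p(t+1)+1$ and $q(t+1)+2$, hence $N=2(P+Q)+\alpha+2\beta$. -/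

namespace PathComplexes

namespace SimplicialComplex

/-! ### Linear maps on combinations of finite sets -/

section Chains

variable {K : Type*} [Field K] {V : Type*}

theorem map_mem_supported {S T : Set (Finset V)} (f : (Finset V →₀ K) →ₗ[K] (Finset V →₀ K))
    (h : ∀ σ ∈ S, f (Finsupp.single σ 1) ∈ Finsupp.supported K K T) {c : Finset V →₀ K}
    (hc : c ∈ Finsupp.supported K K S) : f c ∈ Finsupp.supported K K T := by
  rw [Finsupp.supported_eq_span_single] at hc
  have : Submodule.span K ((fun i => Finsupp.single i (1 : K)) '' S) ≤
      (Finsupp.supported K K T).comap f := by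
    rw [Submodule.span_le]
    rintro _ ⟨σ, hσ, rfl⟩
    exact h σ hσ
  exact this hc

theorem map_congr_supported {S : Set (Finset V)} (f g : (Finset V →₀ K) →ₗ[K] (Finset V →₀ K))
    (h : ∀ σ ∈ S, f (Finsupp.single σ 1) = g (Finsupp.single σ 1)) {c : Finset V →₀ K}
    (hc : c ∈ Finsupp.supported K K S) : f c = g c := by
  rw [Finsupp.supported_eq_span_single] at hc
  have : Submodule.span K ((fun i => Finsupp.single i (1 : K)) '' S) ≤ LinearMap.eqLocus f g := by
    rw [Submodule.span_le]
    rintro _ ⟨σ, hσ, rfl⟩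
    exact h σ hσ
  exact this hc

theorem supported_mono {S T : Set (Finset V)} {c : Finset V →₀ K}
    (hc : c ∈ Finsupp.supported K K S) (h : S ⊆ T) : c ∈ Finsupp.supported K K T :=
  Finsupp.supported_mono h hc

end Chains

/-! ### Insertion and removal of a vertex on chains -/

section Join

variable (K : Type*) [Field K] {V : Type*} [LinearOrder V]

/-- Exterior multiplication by the vertex `v`. -/
noncomputable def join (v : V) : (Finset V →₀ K) →ₗ[K] (Finset V →₀ K) :=
  Finsupp.lsum K fun σ => LinearMap.toSpanSingleton K (Finset V →₀ K)
    (if v ∈ σ then 0 else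
      Finsupp.single (insert v σ) ((-1 : K) ^ (σ.filter (fun w => w < v)).card))

/-- Contraction by the vertex `v`. -/
noncomputable def contract (v : V) : (Finset V →₀ K) →ₗ[K] (Finset V →₀ K) :=
  Finsupp.lsum K fun σ => LinearMap.toSpanSingleton K (Finset V →₀ K)
    (if v ∈ σ then
      Finsupp.single (σ.erase v) ((-1 : K) ^ (σ.filter (fun w => w < v)).card) else 0)

variable {K}

theorem boundary_single (σ : Finset V) (k : K) :
    boundary K (Finsupp.single σ k) =
      ∑ v ∈ σ, Finsupp.single (σ.erase v) (k * (-1 : K) ^ (σ.filter (fun w => w < v)).card) := by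
  simp [boundary, Finset.smul_sum]

theorem join_single_of_mem {v : V} {σ : Finset V} (h : v ∈ σ) (k : K) :
    join K v (Finsupp.single σ k) = 0 := by
  simp [join, h]

theorem join_single_of_notMem {v : V} {σ : Finset V} (h : v ∉ σ) (k : K) :
    join K v (Finsupp.single σ k) =
      Finsupp.single (insert v σ) (k * (-1 : K) ^ (σ.filter (fun w => w < v)).card) := by
  simp [join, h]

theorem contract_single_of_mem {v : V} {σ : Finset V} (h : v ∈ σ) (k : K) :
    contract K v (Finsupp.single σ k) =
      Finsupp.single (σ.erase v) (k * (-1 : K) ^ (σ.filter (fun w => w < v)).card) := by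
  simp [contract, h]

theorem contract_single_of_notMem {v : V} {σ : Finset V} (h : v ∉ σ) (k : K) :
    contract K v (Finsupp.single σ k) = 0 := by
  simp [contract, h]

theorem neg_one_pow_mul_self (n : ℕ) : (-1 : K) ^ n * (-1 : K) ^ n = 1 := by
  rw [← mul_pow]; simp

/-- Inserting $v$ and removing $w$ commute on sets. Of the two position counts exactly one changes,
by one: that of $w$ if $v<w$, that of $v$ if $w<v$. -/
theorem join_sign {v w : V} {σ : Finset V} (hv : v ∉ σ) (hw : w ∈ σ) :
    (-1 : K) ^ (σ.filter (fun u => u < v)).card *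
        (-1 : K) ^ ((insert v σ).filter (fun u => u < w)).card +
      (-1 : K) ^ (σ.filter (fun u => u < w)).card *
        (-1 : K) ^ ((σ.erase w).filter (fun u => u < v)).card = 0 := by
  have hne : v ≠ w := fun h => hv (h ▸ hw)
  rcases lt_or_gt_of_ne hne with h | h
  · rw [Finset.filter_insert, if_pos h, Finset.card_insert_of_notMem (by simp [hv]),
      Finset.filter_erase, Finset.erase_eq_of_notMem (by simp [h.le])]
    ring
  · rw [Finset.filter_insert, if_neg h.le.not_gt, Finset.filter_erase]
    have : w ∈ σ.filter (fun u => u < v) := by simp [hw, h]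
    rw [← Finset.card_erase_add_one this]
    ring

theorem boundary_join_single (v : V) (σ : Finset V) :
    boundary K (join K v (Finsupp.single σ 1)) + join K v (boundary K (Finsupp.single σ 1)) =
      Finsupp.single σ 1 := by
  by_cases hv : v ∈ σ
  · rw [join_single_of_mem hv, map_zero, zero_add, boundary_single, map_sum,
      Finset.sum_eq_single v]
    · rw [join_single_of_notMem (by simp), Finset.insert_erase hv, Finset.filter_erase,
        Finset.erase_eq_of_notMem (by simp), one_mul, neg_one_pow_mul_self]
    · intro w _ hwv
      exact join_single_of_mem (by simp [hv, hwv.symm]) _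
    · exact fun h => absurd hv h
  · rw [join_single_of_notMem hv, boundary_single, boundary_single, Finset.sum_insert hv,
      Finset.erase_insert hv, map_sum, add_assoc, ← Finset.sum_add_distrib,
      Finset.sum_eq_zero, add_zero, one_mul, Finset.filter_insert, if_neg (lt_irrefl v),
      neg_one_pow_mul_self]
    intro w hw
    have hne : v ≠ w := fun h => hv (h ▸ hw)
    rw [join_single_of_notMem (by simp [hv]), Finset.erase_insert_of_ne hne,
      ← Finsupp.single_add, one_mul, one_mul, join_sign hv hw, Finsupp.single_zero]

/-- Joining with $v$ is a contracting homotopy. On sets containing $v$ the join vanishes, and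
joining the boundary gives the set back. -/
theorem boundary_join (v : V) (c : Finset V →₀ K) :
    boundary K (join K v c) = c - join K v (boundary K c) := by
  rw [eq_sub_iff_add_eq]
  refine map_congr_supported (S := Set.univ)
    (boundary K ∘ₗ join K v + join K v ∘ₗ boundary K) LinearMap.id
    (fun σ _ => boundary_join_single v σ) (by simp)

theorem contract_eq_zero {v : V} {c : Finset V →₀ K}
    (hc : c ∈ Finsupp.supported K K {σ | v ∉ σ}) : contract K v c = 0 :=
  map_congr_supported (contract K v) 0 (fun _ hσ => contract_single_of_notMem hσ 1) hc

theorem contract_join {v : V} {c : Finset V →₀ K}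
    (hc : c ∈ Finsupp.supported K K {σ | v ∉ σ}) : contract K v (join K v c) = c := by
  refine map_congr_supported (contract K v ∘ₗ join K v) LinearMap.id (fun σ hσ => ?_) hc
  rw [LinearMap.comp_apply, join_single_of_notMem hσ, contract_single_of_mem (by simp),
    Finset.erase_insert hσ, Finset.filter_insert, if_neg (lt_irrefl v), one_mul,
    neg_one_pow_mul_self, LinearMap.id_apply]

theorem eq_zero_of_add_join_eq_zero {v : V} {a b : Finset V →₀ K}
    (ha : a ∈ Finsupp.supported K K {σ | v ∉ σ}) (hb : b ∈ Finsupp.supported K K {σ | v ∉ σ})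
    (h : a + join K v b = 0) : a = 0 ∧ b = 0 := by
  have hb0 : b = 0 := by
    have := congrArg (contract K v) h
    rwa [map_add, contract_eq_zero ha, contract_join hb, zero_add, map_zero] at this
  subst hb0
  simpa using h

theorem join_mem_supported {v : V} {S T : Set (Finset V)} {c : Finset V →₀ K}
    (hc : c ∈ Finsupp.supported K K S)
    (h : ∀ σ ∈ S, v ∉ σ → insert v σ ∈ T) : join K v c ∈ Finsupp.supported K K T := by
  refine map_mem_supported _ (fun σ hσ => ?_) hc
  by_cases hv : v ∈ σ
  · rw [join_single_of_mem hv]; exact zero_mem _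
  · rw [join_single_of_notMem hv]
    exact Finsupp.single_mem_supported K _ (h σ hσ hv)

theorem boundary_mem_supported {S T : Set (Finset V)} {c : Finset V →₀ K}
    (hc : c ∈ Finsupp.supported K K S)
    (h : ∀ σ ∈ S, ∀ v ∈ σ, σ.erase v ∈ T) : boundary K c ∈ Finsupp.supported K K T := by
  refine map_mem_supported _ (fun σ hσ => ?_) hc
  rw [boundary_single]
  exact Submodule.sum_mem _ fun v hv => Finsupp.single_mem_supported K _ (h σ hσ v hv)

theorem contract_mem_supported {v : V} {S T : Set (Finset V)} {c : Finset V →₀ K}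
    (hc : c ∈ Finsupp.supported K K S)
    (h : ∀ σ ∈ S, v ∈ σ → σ.erase v ∈ T) : contract K v c ∈ Finsupp.supported K K T := by
  refine map_mem_supported _ (fun σ hσ => ?_) hc
  by_cases hv : v ∈ σ
  · rw [contract_single_of_mem hv]
    exact Finsupp.single_mem_supported K _ (h σ hσ hv)
  · rw [contract_single_of_notMem hv]; exact zero_mem _

theorem sub_join_contract_mem {v : V} {S : Set (Finset V)} {c : Finset V →₀ K}
    (hc : c ∈ Finsupp.supported K K S) :
    c - join K v (contract K v c) ∈ Finsupp.supported K K {σ | σ ∈ S ∧ v ∉ σ} := by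
  refine map_mem_supported (LinearMap.id - join K v ∘ₗ contract K v) (fun σ hσ => ?_) hc
  rw [LinearMap.sub_apply, LinearMap.comp_apply, LinearMap.id_apply]
  by_cases hv : v ∈ σ
  · rw [contract_single_of_mem hv, join_single_of_notMem (by simp), Finset.insert_erase hv,
      Finset.filter_erase, Finset.erase_eq_of_notMem (by simp), one_mul, neg_one_pow_mul_self,
      sub_self]
    exact zero_mem _
  · rw [contract_single_of_notMem hv, map_zero, sub_zero]
    exact Finsupp.single_mem_supported K _ ⟨hσ, hv⟩

end Join

/-! ### Links, deletions and cones -/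

section LinkDeletion

variable {V : Type*}

/-- The deletion of a vertex. -/
def deletion (D : SimplicialComplex V) (v : V) : SimplicialComplex V where
  faces := {σ | σ ∈ D.faces ∧ v ∉ σ}
  down_closed := fun _ _ h hG => ⟨D.down_closed h.1 hG, fun hv => h.2 (hG hv)⟩

theorem deletion_faces_subset (D : SimplicialComplex V) (v : V) :
    (D.deletion v).faces ⊆ D.faces := fun _ h => h.1

variable [DecidableEq V]

/-- The link of a vertex. -/
def link (D : SimplicialComplex V) (v : V) : SimplicialComplex V where
  faces := {σ | insert v σ ∈ D.faces ∧ v ∉ σ}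
  down_closed := fun _ _ h hG =>
    ⟨D.down_closed h.1 (Finset.insert_subset_insert v hG), fun hv => h.2 (hG hv)⟩

/-- `D` is a cone with apex `v` (or has no faces). -/
def IsCone (D : SimplicialComplex V) (v : V) : Prop := ∀ σ ∈ D.faces, insert v σ ∈ D.faces

end LinkDeletion

/-! ### One-dimensional total homology through links and deletions -/

section Concentrated

variable (K : Type*) [Field K] {V : Type*} [LinearOrder V]

/-- The total reduced homology of `D` is one-dimensional, spanned by the class of a cycle that is a
combination of faces with `n` elements. -/
def HomologyConcentrated (D : SimplicialComplex V) (n : ℕ) : Prop :=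
  ∃ z ∈ Finsupp.supported K K {σ | σ ∈ D.faces ∧ σ.card = n}, boundary K z = 0 ∧
    (∀ b ∈ Finsupp.supported K K D.faces, boundary K b ≠ z) ∧
    ∀ c ∈ Finsupp.supported K K D.faces, boundary K c = 0 →
      ∃ k : K, ∃ b ∈ Finsupp.supported K K D.faces, c = k • z + boundary K b

variable {K}

theorem boundary_mem {D : SimplicialComplex V} {c : Finset V →₀ K}
    (hc : c ∈ Finsupp.supported K K D.faces) : boundary K c ∈ Finsupp.supported K K D.faces :=
  boundary_mem_supported hc (fun _ hσ v _ => D.down_closed hσ (Finset.erase_subset v _))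

theorem IsCone.exists_boundary_eq {D : SimplicialComplex V} {v : V} (h : D.IsCone v)
    {c : Finset V →₀ K} (hc : c ∈ Finsupp.supported K K D.faces) (h0 : boundary K c = 0) :
    ∃ b ∈ Finsupp.supported K K D.faces, boundary K b = c :=
  ⟨join K v c, join_mem_supported hc (fun σ hσ _ => h σ hσ), by
    rw [boundary_join, h0, map_zero, sub_zero]⟩

theorem exists_eq_add_join {D : SimplicialComplex V} (v : V) {c : Finset V →₀ K}
    (hc : c ∈ Finsupp.supported K K D.faces) :
    ∃ c₀ ∈ Finsupp.supported K K (D.deletion v).faces,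
      ∃ c₁ ∈ Finsupp.supported K K (D.link v).faces, c = c₀ + join K v c₁ := by
  refine ⟨c - join K v (contract K v c), sub_join_contract_mem hc, contract K v c, ?_, ?_⟩
  · refine contract_mem_supported hc (fun σ hσ hv => ⟨?_, by simp⟩)
    rwa [Finset.insert_erase hv]
  · rw [sub_add_cancel]

theorem link_faces_subset_deletion (D : SimplicialComplex V) (v : V) :
    (D.link v).faces ⊆ (D.deletion v).faces :=
  fun _ h => ⟨D.down_closed h.1 (Finset.subset_insert _ _), h.2⟩

theorem join_mem_of_link {D : SimplicialComplex V} {v : V} {c : Finset V →₀ K}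
    (hc : c ∈ Finsupp.supported K K (D.link v).faces) :
    join K v c ∈ Finsupp.supported K K D.faces :=
  join_mem_supported hc (fun _ hσ _ => hσ.1)

/-- Comparison of the two components of the boundary of a chain. -/
theorem boundary_add_join_eq {D : SimplicialComplex V} {v : V} {c₀ c₁ a b : Finset V →₀ K}
    (hc₀ : c₀ ∈ Finsupp.supported K K (D.deletion v).faces)
    (hc₁ : c₁ ∈ Finsupp.supported K K (D.link v).faces)
    (ha : a ∈ Finsupp.supported K K (D.deletion v).faces)
    (hb : b ∈ Finsupp.supported K K (D.deletion v).faces)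
    (h : boundary K (c₀ + join K v c₁) = a + join K v b) :
    boundary K c₀ + c₁ = a ∧ boundary K c₁ = -b := by
  have hsub : (D.deletion v).faces ⊆ {σ | v ∉ σ} := fun _ h => h.2
  have hc₁' := supported_mono hc₁ (link_faces_subset_deletion D v)
  rw [map_add, boundary_join] at h
  have := eq_zero_of_add_join_eq_zero (v := v) (a := boundary K c₀ + c₁ - a)
    (b := -boundary K c₁ - b)
    (supported_mono (Submodule.sub_mem _
      (Submodule.add_mem _ (boundary_mem hc₀) hc₁') ha) hsub)
    (supported_mono (Submodule.sub_mem _ (Submodule.neg_mem _ (boundary_mem hc₁')) hb) hsub)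
    (by rw [map_sub, map_neg]
        have h' := sub_eq_zero.2 h
        rw [← h']; abel)
  refine ⟨sub_eq_zero.1 this.1, ?_⟩
  rw [← sub_eq_zero.1 this.2, neg_neg]

/-- For a cycle $c_0+v*c_1$ the chain $c_1$ is a cycle of the link, a cone, so $c_1=\partial e$
there. Subtracting $-\partial(v*e)$ leaves the cycle $c_0+e$ of the deletion. -/
theorem HomologyConcentrated.of_deletion {D : SimplicialComplex V} {v u : V} {n : ℕ}
    (hu : (D.link v).IsCone u) (h : HomologyConcentrated K (D.deletion v) n) :
    HomologyConcentrated K D n := by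
  obtain ⟨z, hz, hz0, hzb, hc⟩ := h
  have hzD : z ∈ Finsupp.supported K K (D.deletion v).faces := supported_mono hz (fun _ h => h.1)
  refine ⟨z, supported_mono hz (fun _ h => ⟨h.1.1, h.2⟩), hz0, ?_, ?_⟩
  · rintro b hb hbz
    obtain ⟨b₀, hb₀, b₁, hb₁, rfl⟩ := exists_eq_add_join v hb
    obtain ⟨h1, h2⟩ := boundary_add_join_eq hb₀ hb₁ hzD (zero_mem _)
      (by rw [hbz, map_zero, add_zero])
    obtain ⟨e, he, heb⟩ := hu.exists_boundary_eq hb₁ (by rw [h2, neg_zero])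
    exact hzb (b₀ + e)
      (Submodule.add_mem _ hb₀ (supported_mono he (link_faces_subset_deletion D v)))
      (by rw [map_add, heb, h1])
  · intro c hcD hc0
    obtain ⟨c₀, hc₀, c₁, hc₁, rfl⟩ := exists_eq_add_join v hcD
    obtain ⟨h1, h2⟩ := boundary_add_join_eq hc₀ hc₁ (zero_mem _) (zero_mem _)
      (by rw [hc0, map_zero, add_zero])
    obtain ⟨e, he, heb⟩ := hu.exists_boundary_eq hc₁ (by rw [h2, neg_zero])
    obtain ⟨k, b, hb, hkb⟩ := hc (c₀ + e)
      (Submodule.add_mem _ hc₀ (supported_mono he (link_faces_subset_deletion D v)))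
      (by rw [map_add, heb, h1])
    refine ⟨k, b - join K v e, Submodule.sub_mem _
      (supported_mono hb (deletion_faces_subset D v)) (join_mem_of_link he), ?_⟩
    rw [map_sub, boundary_join, heb, ← add_sub_assoc, ← hkb]
    abel

/-- The deletion is acyclic, so the complex behaves like a suspension of the link: a generator $z$
of the link gives $v*z-u*z$, where $u*z$ fills $z$ inside the deletion. -/
theorem HomologyConcentrated.of_link {D : SimplicialComplex V} {v u : V} {n : ℕ}
    (hu : (D.deletion v).IsCone u) (h : HomologyConcentrated K (D.link v) n) :
    HomologyConcentrated K D (n + 1) := by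
  obtain ⟨z, hz, hz0, hzb, hc⟩ := h
  have hzL : z ∈ Finsupp.supported K K (D.link v).faces := supported_mono hz (fun _ h => h.1)
  have hzD := supported_mono hzL (link_faces_subset_deletion D v)
  have hy : join K u z ∈ Finsupp.supported K K (D.deletion v).faces :=
    join_mem_supported hzD (fun σ hσ _ => hu σ hσ)
  refine ⟨join K v z - join K u z, Submodule.sub_mem _ ?_ ?_, ?_, ?_, ?_⟩
  · exact join_mem_supported hz (fun σ hσ hv => ⟨hσ.1.1, by
      rw [Finset.card_insert_of_notMem hv, hσ.2]⟩)
  · exact join_mem_supported hz (fun σ hσ hv => ⟨(hu σ (link_faces_subset_deletion D v hσ.1)).1, by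
      rw [Finset.card_insert_of_notMem hv, hσ.2]⟩)
  · rw [map_sub, boundary_join, boundary_join, hz0, map_zero, map_zero, sub_self]
  · rintro b hb hbz
    obtain ⟨b₀, hb₀, b₁, hb₁, rfl⟩ := exists_eq_add_join v hb
    obtain ⟨-, h2⟩ := boundary_add_join_eq hb₀ hb₁ (Submodule.neg_mem _ hy) hzD
      (by rw [hbz]; abel)
    exact hzb (-b₁) (Submodule.neg_mem _ hb₁) (by rw [map_neg, h2, neg_neg])
  · intro c hcD hc0
    obtain ⟨c₀, hc₀, c₁, hc₁, rfl⟩ := exists_eq_add_join v hcD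
    obtain ⟨h1, h2⟩ := boundary_add_join_eq hc₀ hc₁ (zero_mem _) (zero_mem _)
      (by rw [hc0, map_zero, add_zero])
    obtain ⟨k, b, hb, hkb⟩ := hc c₁ hc₁ (by rw [h2, neg_zero])
    have hbD := supported_mono hb (link_faces_subset_deletion D v)
    -- With $c_1=kz+\partial b$, what remains of $c-k(v*z-u*z)+\partial(v*b)$ is this cycle of the
    -- deletion.
    obtain ⟨e, he, heb⟩ := hu.exists_boundary_eq
      (c := c₀ + k • join K u z + b)
      (Submodule.add_mem _ (Submodule.add_mem _ hc₀ (Submodule.smul_mem _ k hy)) hbD)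
      (by rw [map_add, map_add, map_smul, boundary_join, hz0, map_zero, sub_zero, ← h1, hkb]
          abel)
    refine ⟨k, e - join K v b, Submodule.sub_mem _
      (supported_mono he (deletion_faces_subset D v)) (join_mem_of_link hb), ?_⟩
    rw [map_sub, boundary_join, heb, hkb, map_add, map_smul, smul_sub]
    abel

theorem homologyConcentrated_of_faces_eq_singleton_empty {D : SimplicialComplex V}
    (h : D.faces = {∅}) : HomologyConcentrated K D 0 := by
  have h0 : ∀ c ∈ Finsupp.supported K K D.faces, boundary K c = 0 := fun c hc =>
    map_congr_supported (boundary K) 0 (fun σ hσ => by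
      rw [h] at hσ
      rw [Set.mem_singleton_iff.1 hσ, boundary_single, Finset.sum_empty, LinearMap.zero_apply]) hc
  have hz : Finsupp.single ∅ (1 : K) ∈ Finsupp.supported K K D.faces :=
    Finsupp.single_mem_supported K _ (by simp [h])
  refine ⟨Finsupp.single ∅ 1, Finsupp.single_mem_supported K _ (by simp [h]), h0 _ hz, ?_, ?_⟩
  · intro b hb hbz
    rw [h0 b hb] at hbz
    exact one_ne_zero (Finsupp.single_eq_zero.1 hbz.symm)
  · intro c hc _
    refine ⟨c ∅, 0, zero_mem _, ?_⟩
    rw [map_zero, add_zero]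
    ext σ
    by_cases hσ : σ = ∅
    · subst hσ; simp
    · rw [(Finsupp.mem_supported' K c).1 hc σ (by simpa [h] using hσ)]
      simp [Ne.symm hσ]

end Concentrated

/-! ### From total homology to the graded reduced homology -/

section Graded

variable {K : Type*} [Field K] {V : Type*}

/-- The projection to the combinations of sets with `n` elements. -/
noncomputable def cardPart (K : Type*) [Field K] {V : Type*} (n : ℤ) :
    (Finset V →₀ K) →ₗ[K] (Finset V →₀ K) :=
  Finsupp.lsum K fun σ => LinearMap.toSpanSingleton K (Finset V →₀ K)
    (if (σ.card : ℤ) = n then Finsupp.single σ 1 else 0)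

theorem cardPart_single {n : ℤ} {σ : Finset V} (k : K) :
    cardPart K n (Finsupp.single σ k) = if (σ.card : ℤ) = n then Finsupp.single σ k else 0 := by
  by_cases h : (σ.card : ℤ) = n <;> simp [cardPart, h]

theorem cardPart_eq_self {S : Set (Finset V)} {n : ℤ} (h : ∀ σ ∈ S, (σ.card : ℤ) = n)
    {c : Finset V →₀ K} (hc : c ∈ Finsupp.supported K K S) : cardPart K n c = c :=
  map_congr_supported (cardPart K n) LinearMap.id
    (fun σ hσ => by rw [cardPart_single, if_pos (h σ hσ), LinearMap.id_apply]) hc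

theorem cardPart_eq_zero {S : Set (Finset V)} {n : ℤ} (h : ∀ σ ∈ S, (σ.card : ℤ) ≠ n)
    {c : Finset V →₀ K} (hc : c ∈ Finsupp.supported K K S) : cardPart K n c = 0 :=
  map_congr_supported (cardPart K n) 0
    (fun σ hσ => by rw [cardPart_single, if_neg (h σ hσ), LinearMap.zero_apply]) hc

theorem cardPart_mem {S : Set (Finset V)} (n : ℤ) {c : Finset V →₀ K}
    (hc : c ∈ Finsupp.supported K K S) :
    cardPart K n c ∈ Finsupp.supported K K {σ | σ ∈ S ∧ (σ.card : ℤ) = n} := by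
  refine map_mem_supported _ (fun σ hσ => ?_) hc
  rw [cardPart_single]
  split_ifs with h
  · exact Finsupp.single_mem_supported K _ ⟨hσ, h⟩
  · exact zero_mem _

variable [LinearOrder V]

/-- A bounding chain of mixed degrees can thus be replaced by its part of the right degree. -/
theorem cardPart_boundary (n : ℤ) (c : Finset V →₀ K) :
    cardPart K n (boundary K c) = boundary K (cardPart K (n + 1) c) := by
  induction c using Finsupp.induction_linear with
  | zero => simp only [map_zero]
  | add c d hc hd => simp only [map_add, hc, hd]
  | single σ k =>
  rw [cardPart_single]
  have hb := boundary_mem_supported (S := {σ}) (T := {τ | (τ.card : ℤ) + 1 = σ.card})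
    (Finsupp.single_mem_supported K k (Set.mem_singleton σ))
    (by
      intro τ hτ v hv
      rw [Set.mem_singleton_iff] at hτ
      subst hτ
      have := Finset.card_erase_add_one hv
      rw [Set.mem_ofPred_eq]
      omega)
  split_ifs with h
  · exact cardPart_eq_self (fun τ hτ => by have : (τ.card : ℤ) + 1 = σ.card := hτ; omega) hb
  · rw [map_zero]
    exact cardPart_eq_zero (fun τ hτ => by have : (τ.card : ℤ) + 1 = σ.card := hτ; omega) hb

theorem HomologyConcentrated.subsingleton {D : SimplicialComplex V} {n : ℕ}
    (h : HomologyConcentrated K D n) {i : ℤ} (hi : i + 1 ≠ n) :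
    Subsingleton (D.ReducedHomology K i) := by
  obtain ⟨z, hz, -, -, hc⟩ := h
  rw [Submodule.Quotient.subsingleton_iff, Submodule.submoduleOf_eq_top]
  rintro c ⟨hcD, hc0⟩
  obtain ⟨k, b, hb, hkb⟩ := hc c (supported_mono hcD (fun _ h => h.1)) hc0
  refine ⟨cardPart K (i + 1 + 1) b, cardPart_mem _ hb, ?_⟩
  rw [← cardPart_boundary, ← cardPart_eq_self (fun _ h => h.2) hcD, hkb, map_add, map_smul,
    cardPart_eq_zero (fun σ h => by rw [h.2]; exact fun h => hi h.symm) hz, smul_zero, zero_add]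

theorem HomologyConcentrated.nonempty_equiv {D : SimplicialComplex V} {n : ℕ}
    (h : HomologyConcentrated K D n) {i : ℤ} (hi : i + 1 = n) :
    Nonempty (D.ReducedHomology K i ≃ₗ[K] K) := by
  obtain ⟨z, hz, hz0, hzb, hc⟩ := h
  have hzc : z ∈ D.cycles K i :=
    ⟨supported_mono hz (fun σ h => ⟨h.1, by rw [h.2, hi]⟩), hz0⟩
  let f : K →ₗ[K] D.ReducedHomology K i :=
    LinearMap.toSpanSingleton K _ (Submodule.Quotient.mk ⟨z, hzc⟩)
  refine ⟨(LinearEquiv.ofBijective f ⟨?_, ?_⟩).symm⟩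
  · rw [← LinearMap.ker_eq_bot, LinearMap.ker_eq_bot']
    intro k hk
    by_contra hk0
    have hk' : (Submodule.Quotient.mk (k • ⟨z, hzc⟩) : D.ReducedHomology K i) = 0 := hk
    rw [Submodule.Quotient.mk_eq_zero] at hk'
    obtain ⟨b, hb, hbz⟩ := hk'
    have hbz' : boundary K b = k • z := hbz
    refine hzb (k⁻¹ • b) (Submodule.smul_mem _ _ (supported_mono hb (fun _ h => h.1))) ?_
    rw [map_smul, hbz', smul_smul, inv_mul_cancel₀ hk0, one_smul]
  · intro y
    obtain ⟨⟨c, hcD, hc0⟩, rfl⟩ := Submodule.Quotient.mk_surjective _ y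
    obtain ⟨k, b, hb, hkb⟩ := hc c (supported_mono hcD (fun _ h => h.1)) hc0
    refine ⟨k, ?_⟩
    change (Submodule.Quotient.mk (k • ⟨z, hzc⟩) : D.ReducedHomology K i) = _
    rw [Submodule.Quotient.eq]
    refine ⟨-cardPart K (i + 1 + 1) b, Submodule.neg_mem _ (cardPart_mem _ hb), ?_⟩
    change boundary K (-cardPart K (i + 1 + 1) b) = k • z - c
    have : cardPart K (i + 1) c = c := cardPart_eq_self (fun _ h => h.2) hcD
    rw [map_neg, ← cardPart_boundary, ← this, hkb, map_add, map_smul,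
      cardPart_eq_self (fun σ h => by rw [h.2, hi]) hz]
    abel

end Graded

end SimplicialComplex

end PathComplexes

namespace PathComplexes

namespace SimplicialComplex

/-! ### Complexes of sets that miss a block -/

section Avoiding

variable {V : Type*}

/-- The subsets of `W` that are disjoint from some member of `A`. -/
def avoiding (A : Set (Finset V)) (W : Finset V) : SimplicialComplex V where
  faces := {G | G ⊆ W ∧ ∃ F ∈ A, Disjoint G F}
  down_closed := fun _ _ h hG => ⟨hG.trans h.1, h.2.imp fun _ hF => ⟨hF.1, hF.2.mono_left hG⟩⟩

variable [DecidableEq V]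

theorem deletion_avoiding (A : Set (Finset V)) (W : Finset V) (v : V) :
    (avoiding A W).deletion v = avoiding A (W.erase v) := by
  ext G
  simp only [deletion, avoiding, Set.mem_ofPred_eq, Finset.subset_erase]
  tauto

theorem link_avoiding (A : Set (Finset V)) {W : Finset V} {v : V} (hv : v ∈ W) :
    (avoiding A W).link v = avoiding {F | F ∈ A ∧ v ∉ F} (W.erase v) := by
  ext G
  simp only [link, avoiding, Set.mem_ofPred_eq, Finset.subset_erase, Finset.insert_subset_iff,
    Finset.disjoint_insert_left]
  grind

theorem isCone_avoiding_of_notMem {A : Set (Finset V)} {W : Finset V} {v : V} (hv : v ∈ W)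
    (h : ∀ F ∈ A, v ∉ F) : (avoiding A W).IsCone v := by
  rintro G ⟨hG, F, hF, hGF⟩
  exact ⟨Finset.insert_subset hv hG, F, hF, Finset.disjoint_insert_left.2 ⟨h F hF, hGF⟩⟩

theorem isCone_avoiding_of_disjoint {A : Set (Finset V)} {W F : Finset V} {v : V} (hv : v ∈ W)
    (hF : F ∈ A) (h : Disjoint W F) : (avoiding A W).IsCone v := by
  rintro G ⟨hG, -⟩
  have := Finset.insert_subset hv hG
  exact ⟨this, F, hF, h.mono_left this⟩

end Avoiding

/-! ### The two moves and their effect on homology -/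

section Transversal

variable (K : Type*) [Field K] {V : Type*} [LinearOrder V]

/-- The sets `G ⊆ W` that meet all members of `A` span a quotient complex with one-dimensional
homology, spanned by a class of sets with `n` elements. It is expressed through the subcomplex
of the sets that avoid some member of `A`. -/
def TransversalConcentrated (A : Set (Finset V)) (W : Finset V) : ℕ → Prop
  | 0 => A = ∅ ∧ W = ∅
  | n + 1 => W.Nonempty ∧ HomologyConcentrated K (avoiding A W) n

variable {K}

theorem TransversalConcentrated.of_erase_dominating {A : Set (Finset V)} {W : Finset V} {v w : V}
    {n : ℕ} (hv : v ∈ W) (hw : w ∈ W) (hne : v ≠ w) (h : ∀ F ∈ A, v ∈ F → w ∈ F)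
    (hA : TransversalConcentrated K A (W.erase w) n) : TransversalConcentrated K A W n := by
  have hv' : v ∈ W.erase w := Finset.mem_erase.2 ⟨hne, hv⟩
  cases n with
  | zero => simp [hA.2] at hv'
  | succ n =>
    refine ⟨⟨v, hv⟩, HomologyConcentrated.of_deletion (v := w) (u := v) ?_ ?_⟩
    · rw [link_avoiding A hw]
      exact isCone_avoiding_of_notMem hv' fun F hF hvF => hF.2 (h F hF.1 hvF)
    · rw [deletion_avoiding]
      exact hA.2

theorem TransversalConcentrated.of_forced {A : Set (Finset V)} {W F : Finset V} {v : V} {n : ℕ}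
    (hv : v ∈ W) (hF : F ∈ A) (h : ∀ u ∈ W, u ∈ F → u = v)
    (hA : TransversalConcentrated K {F | F ∈ A ∧ v ∉ F} (W.erase v) n) :
    TransversalConcentrated K A W (n + 1) := by
  refine ⟨⟨v, hv⟩, ?_⟩
  have hdis : Disjoint (W.erase v) F := Finset.disjoint_left.2 fun u hu huF =>
    Finset.ne_of_mem_erase hu (h u (Finset.mem_of_mem_erase hu) huF)
  cases n with
  -- Here $W=\{v\}$, so the deletion of $v$ has no point to serve as an apex; the complex is
  -- $\{\emptyset\}$ and is treated directly.
  | zero =>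
    obtain ⟨hA0, hW0⟩ := hA
    have hall : ∀ F ∈ A, v ∈ F := fun F hF => by
      by_contra hvF
      exact (Set.ext_iff.1 hA0 F).1 ⟨hF, hvF⟩
    apply homologyConcentrated_of_faces_eq_singleton_empty
    ext G
    constructor
    · rintro ⟨hGW, F', hF', hd⟩
      refine Finset.eq_empty_of_forall_notMem fun u hu => ?_
      have huv : u = v := by
        by_contra huv
        have : u ∈ W.erase v := Finset.mem_erase.2 ⟨huv, hGW hu⟩
        simp [hW0] at this
      exact Finset.disjoint_left.1 hd hu (huv ▸ hall F' hF')
    · intro hG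
      rw [Set.mem_singleton_iff] at hG
      subst hG
      exact ⟨Finset.empty_subset _, F, hF, Finset.disjoint_empty_left _⟩
  | succ n =>
    obtain ⟨⟨u, hu⟩, hH⟩ := hA
    refine HomologyConcentrated.of_link (v := v) (u := u) ?_ ?_
    · rw [deletion_avoiding]
      exact isCone_avoiding_of_disjoint hu hF hdis
    · rw [link_avoiding A hv]
      exact hH

end Transversal

/-! ### Reductions of incidence relations -/

/-- The incidence relation `r` between the points `X` and the blocks `A` reduces to nothing by
deleting points whose blocks include all the blocks of another point, and by `n` times choosing
a point that is the only one of some block (with removal of the blocks through it). -/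
inductive Collapses {α ι : Type*} [DecidableEq α] (r : α → ι → Prop) :
    Finset α → Set ι → ℕ → Prop
  | nil : Collapses r ∅ ∅ 0
  | dominate {X : Finset α} {A : Set ι} {n : ℕ} (v w : α) : v ∈ X → w ∈ X → v ≠ w →
      (∀ a ∈ A, r v a → r w a) → Collapses r (X.erase w) A n → Collapses r X A n
  | force {X : Finset α} {A : Set ι} {n : ℕ} (v : α) (a : ι) : v ∈ X → a ∈ A → r v a →
      (∀ u ∈ X, r u a → u = v) → Collapses r (X.erase v) {b | b ∈ A ∧ ¬ r v b} n →
      Collapses r X A (n + 1)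

namespace Collapses

variable {α ι : Type*} [DecidableEq α] {r : α → ι → Prop}

/-- The dominated witnesses lie in $Y$, which is never touched, so the points outside $Y$ can be
deleted one by one in any order. -/
theorem of_subset {X Y : Finset α} {A : Set ι} {n : ℕ} (hYX : Y ⊆ X)
    (h : ∀ w ∈ X, w ∉ Y → ∃ v ∈ Y, ∀ a ∈ A, r v a → r w a) (hY : Collapses r Y A n) :
    Collapses r X A n := by
  induction X using Finset.strongInduction with
  | H X ih =>
    rcases hYX.eq_or_ssubset with rfl | hss
    · exact hY
    · obtain ⟨w, hwX, hwY⟩ := Finset.exists_of_ssubset hss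
      obtain ⟨v, hv, hvw⟩ := h w hwX hwY
      refine dominate v w (hYX hv) hwX (fun e => hwY (e ▸ hv)) hvw ?_
      refine ih _ (Finset.erase_ssubset hwX) ?_ ?_
      · exact fun y hy => Finset.mem_erase.2 ⟨fun e => hwY (e ▸ hy), hYX hy⟩
      · exact fun u hu huY => h u (Finset.mem_of_mem_erase hu) huY

theorem image {β : Type*} [DecidableEq β] {r' : β → ι → Prop} {e : α → β} {X : Finset α}
    {A : Set ι} {n : ℕ} (h : Collapses r X A n) (he : Set.InjOn e X)
    (hr : ∀ k ∈ X, ∀ a ∈ A, r' (e k) a ↔ r k a) : Collapses r' (X.image e) A n := by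
  have erase : ∀ (X : Finset α) (v : α), v ∈ X → Set.InjOn e X →
      (X.image e).erase (e v) = (X.erase v).image e := by
    intro X v hv he
    ext y
    simp only [Finset.mem_erase, Finset.mem_image]
    constructor
    · rintro ⟨hy, u, hu, rfl⟩
      exact ⟨u, ⟨fun h => hy (h ▸ rfl), hu⟩, rfl⟩
    · rintro ⟨u, ⟨huv, hu⟩, rfl⟩
      exact ⟨fun h => huv (he hu hv h), u, hu, rfl⟩
  induction h with
  | nil => exact nil
  | @dominate X A n v w hv hw hne hd _ ih =>
    refine dominate (e v) (e w) (Finset.mem_image_of_mem e hv) (Finset.mem_image_of_mem e hw)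
      (fun h => hne (he hv hw h)) (fun a ha => ?_) ?_
    · rw [hr v hv a ha, hr w hw a ha]
      exact hd a ha
    · rw [erase X w hw he]
      exact ih (he.mono (by simp)) fun k hk => hr k (Finset.mem_of_mem_erase hk)
  | @force X A n v a hv ha hva hu _ ih =>
    refine force (e v) a (Finset.mem_image_of_mem e hv) ha ((hr v hv a ha).2 hva) ?_ ?_
    · intro y hy hya
      obtain ⟨u, huX, rfl⟩ := Finset.mem_image.1 hy
      rw [hu u huX ((hr u huX a ha).1 hya)]
    · have hA : {b | b ∈ A ∧ ¬ r' (e v) b} = {b | b ∈ A ∧ ¬ r v b} := by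
        ext b
        exact and_congr_right fun hb => not_congr (hr v hv b hb)
      rw [erase X v hv he, hA]
      exact ih (he.mono (by simp)) fun k hk b hb => hr k (Finset.mem_of_mem_erase hk) b hb.1

/-- A collapsible family can be added to a family on a disjoint vertex set. -/
theorem transversalConcentrated_union {K : Type*} [Field K] {V : Type*} [LinearOrder V]
    {X : Finset α} {A : Set ι} {k n : ℕ} (h : Collapses r X A k) {x : α → V} {f : ι → Finset V}
    {B : Set (Finset V)} {W : Finset V} (hx : Set.InjOn x X)
    (hr : ∀ v ∈ X, ∀ a ∈ A, x v ∈ f a ↔ r v a) (hW : ∀ v ∈ X, x v ∉ W)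
    (hfW : ∀ a ∈ A, ∀ w ∈ W, w ∉ f a) (hB : ∀ F ∈ B, ∀ v ∈ X, x v ∉ F)
    (hBW : TransversalConcentrated K B W n) :
    TransversalConcentrated K (B ∪ f '' A) (W ∪ X.image x) (n + k) := by
  have erase : ∀ (X : Finset α) (v : α), v ∈ X → Set.InjOn x X → (∀ v ∈ X, x v ∉ W) →
      (W ∪ X.image x).erase (x v) = W ∪ (X.erase v).image x := by
    intro X v hv hx hW
    ext y
    simp only [Finset.mem_erase, Finset.mem_image, Finset.mem_union]
    constructor
    · rintro ⟨hy, hyW | ⟨u, hu, rfl⟩⟩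
      · exact Or.inl hyW
      · exact Or.inr ⟨u, ⟨fun h => hy (h ▸ rfl), hu⟩, rfl⟩
    · rintro (hyW | ⟨u, ⟨huv, hu⟩, rfl⟩)
      · exact ⟨fun h => hW v hv (h ▸ hyW), Or.inl hyW⟩
      · exact ⟨fun h => huv (hx hu hv h), Or.inr ⟨u, hu, rfl⟩⟩
  have mem : ∀ (X : Finset α) (v : α), v ∈ X → x v ∈ W ∪ X.image x := fun X v hv =>
    Finset.mem_union_right _ (Finset.mem_image_of_mem x hv)
  induction h with
  | nil => simpa using hBW
  | @dominate X A k v w hv hw hne hd _ ih =>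
    refine TransversalConcentrated.of_erase_dominating (v := x v) (w := x w) (mem X v hv)
      (mem X w hw) (fun h => hne (hx hv hw h)) ?_ ?_
    · rintro F (hF | ⟨a, ha, rfl⟩) hvF
      · exact absurd hvF (hB F hF v hv)
      · rw [hr v hv a ha] at hvF
        exact (hr w hw a ha).2 (hd a ha hvF)
    · rw [erase X w hw hx hW]
      exact ih (hx.mono (by simp)) (fun u hu => hr u (Finset.mem_of_mem_erase hu))
        (fun u hu => hW u (Finset.mem_of_mem_erase hu)) hfW
        (fun F hF u hu => hB F hF u (Finset.mem_of_mem_erase hu))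
  | @force X A k v a hv ha _ hu _ ih =>
    refine TransversalConcentrated.of_forced (v := x v) (F := f a) (mem X v hv)
      (Or.inr ⟨a, ha, rfl⟩) ?_ ?_
    · intro y hy hya
      rcases Finset.mem_union.1 hy with hyW | hyX
      · exact absurd hya (hfW a ha y hyW)
      · obtain ⟨u, huX, rfl⟩ := Finset.mem_image.1 hyX
        rw [hu u huX ((hr u huX a ha).1 hya)]
    · have hA : {F | F ∈ B ∪ f '' A ∧ x v ∉ F} = B ∪ f '' {b | b ∈ A ∧ ¬ r v b} := by
        ext F
        constructor
        · rintro ⟨hF | ⟨b, hb, rfl⟩, hvF⟩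
          · exact Or.inl hF
          · exact Or.inr ⟨b, ⟨hb, fun h => hvF ((hr v hv b hb).2 h)⟩, rfl⟩
        · rintro (hF | ⟨b, ⟨hb, hvb⟩, rfl⟩)
          · exact ⟨Or.inl hF, hB F hF v hv⟩
          · exact ⟨Or.inr ⟨b, hb, rfl⟩, fun h => hvb ((hr v hv b hb).1 h)⟩
      rw [erase X v hv hx hW, hA]
      exact ih (hx.mono (by simp)) (fun u hu b hb => hr u (Finset.mem_of_mem_erase hu) b hb.1)
        (fun u hu => hW u (Finset.mem_of_mem_erase hu)) (fun b hb => hfW b hb.1)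
        (fun F hF u hu => hB F hF u (Finset.mem_of_mem_erase hu))

end Collapses

end SimplicialComplex

end PathComplexes

namespace PathComplexes

namespace SimplicialComplex

namespace Collapses

/-! ### Collapsing intervals of integers -/

section Intervals

variable {t : ℕ}

/-- One period of the recursion: the same configuration reappears with $b$ replaced by $b+t+1$.
Block $b+1$ has only the point $b+t$ left; forcing it removes blocks $b+1,\dots,b+t$. -/
theorem interior_step (ht : 1 ≤ t) {b n k : ℕ} (h : b + t < n)
    (hc : Collapses (fun j i => i ≤ j ∧ j < i + t) (Finset.Icc (b + t + 1 + t) n)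
      (Set.Icc (b + t + 1 + 1) n) k) :
    Collapses (fun j i => i ≤ j ∧ j < i + t) (Finset.Icc (b + t) n) (Set.Icc (b + 1) n)
      (k + 2) := by
  refine force (b + t) (b + 1) (Finset.mem_Icc.2 (by omega)) (Set.mem_Icc.2 (by omega)) (by omega)
    (fun u hu => by rw [Finset.mem_Icc] at hu; omega) ?_
  have hA : {i | i ∈ Set.Icc (b + 1) n ∧ ¬(i ≤ b + t ∧ b + t < i + t)} =
      Set.Icc (b + t + 1) n := by
    ext i; simp only [Set.mem_ofPred_eq, Set.mem_Icc]; omega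
  have hX : (Finset.Icc (b + t) n).erase (b + t) = Finset.Icc (b + t + 1) n := by
    ext i; simp only [Finset.mem_erase, Finset.mem_Icc]; omega
  rw [hA, hX]
  -- The point $b+t+1$ now lies only in block $b+t+1$, so it makes the other points of that block
  -- deletable and is then forced.
  refine of_subset (Y := insert (b + t + 1) (Finset.Icc (b + t + 1 + t) n)) ?_ ?_ ?_
  · intro i; simp only [Finset.mem_insert, Finset.mem_Icc]; omega
  · intro w hw hwY
    refine ⟨b + t + 1, Finset.mem_insert_self _ _, fun a ha => ?_⟩
    simp only [Finset.mem_insert, Finset.mem_Icc, Set.mem_Icc] at *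
    omega
  · refine force (b + t + 1) (b + t + 1) (Finset.mem_insert_self _ _)
      (Set.mem_Icc.2 (by omega)) (by omega)
      (fun u hu => by rw [Finset.mem_insert, Finset.mem_Icc] at hu; omega) ?_
    have hA : {i | i ∈ Set.Icc (b + t + 1) n ∧ ¬(i ≤ b + t + 1 ∧ b + t + 1 < i + t)} =
        Set.Icc (b + t + 1 + 1) n := by
      ext i; simp only [Set.mem_ofPred_eq, Set.mem_Icc]; omega
    rw [hA, Finset.erase_insert (by rw [Finset.mem_Icc]; omega)]
    exact hc

/-- Modulo $t+1$, the lengths $0$ and $t$ of the block range are the ones for which points and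
blocks run out together. -/
theorem interior_of_dvd (ht : 1 ≤ t) (q b : ℕ) :
    Collapses (fun j i => i ≤ j ∧ j < i + t) (Finset.Icc (b + t) (b + q * (t + 1)))
      (Set.Icc (b + 1) (b + q * (t + 1))) (2 * q) := by
  induction q generalizing b with
  | zero =>
    rw [Finset.Icc_eq_empty (by omega), Set.Icc_eq_empty (by omega)]
    exact nil
  | succ q ih =>
    have h : b + (q + 1) * (t + 1) = b + t + 1 + q * (t + 1) := by ring
    rw [h]
    exact interior_step ht (by omega) (ih (b + t + 1))

theorem interior_of_dvd_succ (ht : 1 ≤ t) (p b : ℕ) :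
    Collapses (fun j i => i ≤ j ∧ j < i + t) (Finset.Icc (b + t) (b + p * (t + 1) + t))
      (Set.Icc (b + 1) (b + p * (t + 1) + t)) (2 * p + 1) := by
  induction p generalizing b with
  | zero =>
    refine force (b + t) (b + 1) (Finset.mem_Icc.2 (by omega)) (Set.mem_Icc.2 (by omega))
      (by omega) (fun u hu => by rw [Finset.mem_Icc] at hu; omega) ?_
    have hA : {i | i ∈ Set.Icc (b + 1) (b + 0 * (t + 1) + t) ∧
        ¬(i ≤ b + t ∧ b + t < i + t)} = ∅ := by
      ext i; simp only [Set.mem_ofPred_eq, Set.mem_Icc, Set.mem_empty_iff_false, iff_false]; omega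
    have hX : (Finset.Icc (b + t) (b + 0 * (t + 1) + t)).erase (b + t) = ∅ := by
      ext i; simp only [Finset.mem_erase, Finset.mem_Icc, Finset.notMem_empty, iff_false]; omega
    rw [hA, hX]
    exact nil
  | succ p ih =>
    have h : b + (p + 1) * (t + 1) + t = b + t + 1 + p * (t + 1) + t := by ring
    rw [h]
    exact interior_step ht (by omega) (ih (b + t + 1))

/-- The extreme points $0$ and $n+t$ lie only in the first and last block respectively. They make
the other points outside $[t,n]$ deletable, and are then forced. -/
theorem range_of_interior (ht : 1 ≤ t) {n k : ℕ}
    (hc : Collapses (fun j i => i ≤ j ∧ j < i + t) (Finset.Icc t n) (Set.Icc 1 n) k) :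
    Collapses (fun j i => i ≤ j ∧ j < i + t) (Finset.range (n + t + 1)) (Set.Iio (n + 2))
      (k + 2) := by
  refine of_subset (Y := insert 0 (insert (n + t) (Finset.Icc t n))) ?_ ?_ ?_
  · intro i; simp only [Finset.mem_insert, Finset.mem_Icc, Finset.mem_range]; omega
  · intro w hw hwY
    simp only [Finset.mem_insert, Finset.mem_Icc, Finset.mem_range] at hw hwY
    by_cases hwt : w < t
    · refine ⟨0, by simp, fun a _ => by omega⟩
    · refine ⟨n + t, by simp, fun a ha => ?_⟩
      rw [Set.mem_Iio] at ha
      omega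
  · refine force 0 0 (by simp) (by simp) (by omega)
      (fun u hu => by simp only [Finset.mem_insert, Finset.mem_Icc] at hu; omega) ?_
    have hA : {i | i ∈ Set.Iio (n + 2) ∧ ¬(i ≤ 0 ∧ 0 < i + t)} = Set.Icc 1 (n + 1) := by
      ext i; simp only [Set.mem_ofPred_eq, Set.mem_Icc, Set.mem_Iio]; omega
    rw [hA, Finset.erase_insert (by simp only [Finset.mem_insert, Finset.mem_Icc]; omega)]
    refine force (n + t) (n + 1) (by simp) (by simp) (by omega)
      (fun u hu => by simp only [Finset.mem_insert, Finset.mem_Icc] at hu; omega) ?_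
    have hA : {i | i ∈ Set.Icc 1 (n + 1) ∧ ¬(i ≤ n + t ∧ n + t < i + t)} = Set.Icc 1 n := by
      ext i; simp only [Set.mem_ofPred_eq, Set.mem_Icc]; omega
    rw [hA, Finset.erase_insert (by simp only [Finset.mem_Icc]; omega)]
    exact hc

theorem range_mul_add_one (ht : 1 ≤ t) (p : ℕ) :
    Collapses (fun j i => i ≤ j ∧ j < i + t) (Finset.range (p * (t + 1) + t))
      (Set.Iio (p * (t + 1) + 1)) (2 * p + 1) := by
  cases p with
  -- A single block has no separate first and last block, so `range_of_interior` does not apply.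
  | zero =>
    refine of_subset (Y := {0}) ?_ ?_ ?_
    · intro i; simp only [Finset.mem_singleton, Finset.mem_range]; omega
    · intro w hw _
      rw [Finset.mem_range] at hw
      exact ⟨0, by simp, fun a _ => by omega⟩
    · refine force 0 0 (by simp) (by simp) (by omega) (by simp) ?_
      have hA : {i | i ∈ Set.Iio (0 * (t + 1) + 1) ∧ ¬(i ≤ 0 ∧ 0 < i + t)} = ∅ := by
        ext i; simp only [Set.mem_ofPred_eq, Set.mem_Iio, Set.mem_empty_iff_false, iff_false]; omega
      rw [hA, Finset.erase_singleton]
      exact nil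
  | succ p =>
    have h := range_of_interior ht (by simpa using interior_of_dvd_succ ht p 0)
    have h₁ : (p + 1) * (t + 1) + t = p * (t + 1) + t + t + 1 := by ring
    have h₂ : (p + 1) * (t + 1) + 1 = p * (t + 1) + t + 2 := by ring
    rw [h₁, h₂]
    exact h

theorem range_mul_add_two (ht : 1 ≤ t) (q : ℕ) :
    Collapses (fun j i => i ≤ j ∧ j < i + t) (Finset.range (q * (t + 1) + t + 1))
      (Set.Iio (q * (t + 1) + 2)) (2 * q + 2) :=
  range_of_interior ht (by simpa using interior_of_dvd ht q 0)

/-- The vertices `j * l + s` suffice to describe a run. -/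
theorem run_of_range (ht : 1 ≤ t) {l m s r k : ℕ} (hm : m = t * l + s) (hs : s < l)
    (hr : 1 ≤ r) (hc : Collapses (fun j i => i ≤ j ∧ j < i + t) (Finset.range (r - 1 + t))
      (Set.Iio r) k) :
    Collapses (fun v i => i * l ≤ v ∧ v < i * l + m) (Finset.range ((r - 1) * l + m))
      (Set.Iio r) k := by
  have hl : 0 < l := by omega
  have key : ∀ j u i, u < l → (i * l ≤ j * l + u ↔ i ≤ j) := by
    intro j u i hu
    constructor
    · intro h
      by_contra hij
      have : (j + 1) * l ≤ i * l := Nat.mul_le_mul_right l (by omega)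
      rw [add_mul] at this
      omega
    · intro h
      have := Nat.mul_le_mul_right l h
      omega
  -- A vertex $jl+u$ with $u<s$ lies in one more potential block, $i=j-t$, than one with $u\ge s$.
  -- Hence $u=s$ gives the fewest blocks for each $j$.
  have key' : ∀ j u i, u < l → (j * l + u < i * l + m ↔ j < i + t ∨ (j = i + t ∧ u < s)) := by
    intro j u i hu
    have hexp : i * l + m = (i + t) * l + s := by rw [hm]; ring
    rw [hexp]
    rcases lt_trichotomy j (i + t) with h | h | h
    · have : (j + 1) * l ≤ (i + t) * l := Nat.mul_le_mul_right l (by omega)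
      rw [add_mul] at this
      constructor <;> intro <;> omega
    · subst h; omega
    · have : (i + t + 1) * l ≤ j * l := Nat.mul_le_mul_right l (by omega)
      rw [add_mul] at this
      constructor <;> intro <;> omega
  have hexp : (r - 1) * l + m = (r - 1 + t) * l + s := by rw [hm]; ring
  refine of_subset (Y := (Finset.range (r - 1 + t)).image fun j => j * l + s) ?_ ?_ ?_
  · intro v hv
    obtain ⟨j, hj, rfl⟩ := Finset.mem_image.1 hv
    rw [Finset.mem_range] at hj ⊢
    have := (key' j s (r - 1) hs).2
    omega
  · intro v hv _
    obtain ⟨j, u, hu, rfl⟩ : ∃ j u, u < l ∧ v = j * l + u :=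
      ⟨v / l, v % l, Nat.mod_lt _ hl, by rw [mul_comm]; exact (Nat.div_add_mod v l).symm⟩
    rw [Finset.mem_range, key' j u (r - 1) hu] at hv
    by_cases hj : j < r - 1 + t
    · refine ⟨j * l + s, Finset.mem_image.2 ⟨j, Finset.mem_range.2 hj, rfl⟩, fun i _ => ?_⟩
      rw [key _ _ _ hs, key _ _ _ hu, key' _ _ _ hs, key' _ _ _ hu]
      omega
    -- The leftover vertices beyond $(r-1+t)l$ lie in the last block, which is the only block of the
    -- witness.
    · refine ⟨(r - 1 + t - 1) * l + s,
        Finset.mem_image.2 ⟨r - 1 + t - 1, Finset.mem_range.2 (by omega), rfl⟩, fun i hi => ?_⟩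
      rw [Set.mem_Iio] at hi
      rw [key _ _ _ hs, key _ _ _ hu, key' _ _ _ hs, key' _ _ _ hu]
      omega
  · refine hc.image ?_ ?_
    · intro a _ b _ h
      exact Nat.eq_of_mul_eq_mul_right hl (Nat.add_right_cancel h)
    · intro j _ i _
      rw [key _ _ _ hs, key' _ _ _ hs]
      omega

end Intervals

end Collapses

end SimplicialComplex

end PathComplexes

namespace PathComplexes

namespace SimplicialComplex

/-! ### Labelled vertices and facets of a run -/

section Runs

variable {l m : ℕ}

theorem mem_line_vertexSet (hl : 0 < l) (hlm : l ≤ m) {r : ℕ} (hr : 1 ≤ r) (v : ℕ) :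
    v ∈ (line m l r).vertexSet ↔ v < (r - 1) * l + m := by
  have hiff : v ∈ (line m l r).vertexSet ↔ ∃ a < r, a * l ≤ v ∧ v < a * l + m := by
    simp [vertexSet, line, generated]
  rw [hiff]
  constructor
  · rintro ⟨a, ha, -, hv⟩
    have := Nat.mul_le_mul_right l (show a ≤ r - 1 by omega)
    omega
  · intro hv
    by_cases h : v < (r - 1) * l
    · have hdiv := Nat.div_add_mod v l
      have hmod := Nat.mod_lt v hl
      rw [mul_comm] at hdiv
      have : v / l < r - 1 := by
        by_contra hc
        have := Nat.mul_le_mul_right l (not_lt.1 hc)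
        omega
      exact ⟨v / l, by omega, by omega, by omega⟩
    · exact ⟨r - 1, by omega, by omega, by omega⟩

theorem IsRun.exists_labelling {V : Type*} [DecidableEq V] (hl : 0 < l) (hlm : l ≤ m) {r : ℕ}
    (hr : 1 ≤ r) {R : SimplicialComplex V} (h : IsRun m l r R) :
    ∃ x : ℕ → V, Set.InjOn x (Finset.range ((r - 1) * l + m)) ∧
      ∀ G : Finset V, G ∈ R.faces ↔ ∃ a < r, G ⊆ (Finset.Ico (a * l) (a * l + m)).image x := by
  obtain ⟨x, hx, hR⟩ := h
  refine ⟨x, hx.mono fun v hv => ?_, fun G => ?_⟩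
  · rw [mem_line_vertexSet hl hlm hr]
    simpa using hv
  · rw [hR]
    constructor
    · rintro ⟨F, ⟨_, ⟨a, ha, rfl⟩, hF⟩, hG⟩
      refine ⟨a, ha, ?_⟩
      rw [← Finset.coe_subset, hG, Finset.coe_image, Finset.coe_Ico]
      exact Set.image_mono hF
    · rintro ⟨a, ha, hG⟩
      refine ⟨(Finset.Ico (a * l) (a * l + m)).filter fun k => x k ∈ G,
        ⟨_, ⟨a, ha, rfl⟩, fun k hk => ?_⟩, ?_⟩
      · simpa using (Finset.mem_filter.1 hk).1
      · ext v
        constructor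
        · intro hv
          obtain ⟨k, hk, rfl⟩ := Finset.mem_image.1 (hG hv)
          exact ⟨k, Finset.mem_filter.2 ⟨hk, hv⟩, rfl⟩
        · rintro ⟨k, hk, rfl⟩
          exact (Finset.mem_filter.1 hk).2

theorem mem_Ico_lt {r a k : ℕ} (ha : a < r) (hk : k ∈ Finset.Ico (a * l) (a * l + m)) :
    k < (r - 1) * l + m := by
  rw [Finset.mem_Ico] at hk
  have := Nat.mul_le_mul_right l (show a ≤ r - 1 by omega)
  omega

theorem exists_mem_Ico (hl : 0 < l) (hlm : l ≤ m) {r k : ℕ} (hr : 1 ≤ r)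
    (hk : k < (r - 1) * l + m) : ∃ a < r, k ∈ Finset.Ico (a * l) (a * l + m) := by
  have h := (mem_line_vertexSet hl hlm hr k).2 hk
  simpa [vertexSet, line, generated] using h

end Runs

/-! ### Disjoint unions of runs -/

section DisjointUnion

variable {K : Type*} [Field K] {V : Type*} [LinearOrder V] {ι : Type*} {l m : ℕ}
  {s e : ι → ℕ} {x : ι → ℕ → V}

/-- Labelled runs on pairwise disjoint vertex sets: the transversal degrees add up. -/
theorem transversalConcentrated_biUnion [DecidableEq ι]
    (hx : ∀ j, Set.InjOn (x j) (Finset.range ((s j - 1) * l + m)))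
    (hdis : ∀ j j', j ≠ j' → ∀ k < (s j - 1) * l + m, ∀ k' < (s j' - 1) * l + m,
      x j k ≠ x j' k')
    (hc : ∀ j, Collapses (fun v i => i * l ≤ v ∧ v < i * l + m)
      (Finset.range ((s j - 1) * l + m)) (Set.Iio (s j)) (e j)) (S : Finset ι) :
    TransversalConcentrated K
      {F | ∃ j ∈ S, ∃ a < s j, F = (Finset.Ico (a * l) (a * l + m)).image (x j)}
      (S.biUnion fun j => (Finset.range ((s j - 1) * l + m)).image (x j)) (∑ j ∈ S, e j) := by
  induction S using Finset.induction_on with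
  | empty => exact ⟨by ext; simp, by simp⟩
  | insert j S hj ih =>
    have hne : ∀ j' ∈ S, j' ≠ j := fun j' hj' h => hj (h ▸ hj')
    have h := (hc j).transversalConcentrated_union (x := x j)
      (f := fun a => (Finset.Ico (a * l) (a * l + m)).image (x j)) (hx j) ?_ ?_ ?_ ?_ ih
    · rw [Finset.sum_insert hj, add_comm, Finset.biUnion_insert, Finset.union_comm]
      convert h using 1
      ext F
      simp only [Set.mem_ofPred_eq, Finset.mem_insert, Set.mem_union, Set.mem_image, Set.mem_Iio]
      constructor
      · rintro ⟨j', rfl | hj', a, ha, rfl⟩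
        · exact Or.inr ⟨a, ha, rfl⟩
        · exact Or.inl ⟨j', hj', a, ha, rfl⟩
      · rintro (⟨j', hj', a, ha, rfl⟩ | ⟨a, ha, rfl⟩)
        · exact ⟨j', Or.inr hj', a, ha, rfl⟩
        · exact ⟨j, Or.inl rfl, a, ha, rfl⟩
    · intro v hv a ha
      rw [Finset.mem_image, ← Finset.mem_Ico]
      constructor
      · rintro ⟨k, hk, hkv⟩
        rwa [← hx j (by simpa using mem_Ico_lt ha hk) hv hkv]
      · exact fun h => ⟨v, h, rfl⟩
    · intro v hv hmem
      obtain ⟨j', hj', hk⟩ := Finset.mem_biUnion.1 hmem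
      obtain ⟨k, hk, hkv⟩ := Finset.mem_image.1 hk
      exact hdis j' j (hne j' hj') k (Finset.mem_range.1 hk) v (Finset.mem_range.1 hv) hkv
    · intro a ha w hw hwa
      obtain ⟨j', hj', hw⟩ := Finset.mem_biUnion.1 hw
      obtain ⟨k, hk, rfl⟩ := Finset.mem_image.1 hw
      obtain ⟨k', hk', hkk⟩ := Finset.mem_image.1 hwa
      exact hdis j' j (hne j' hj') k (Finset.mem_range.1 hk) k' (mem_Ico_lt ha hk') hkk.symm
    · rintro F ⟨j', hj', a, ha, rfl⟩ v hv hmem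
      obtain ⟨k, hk, hkv⟩ := Finset.mem_image.1 hmem
      exact hdis j' j (hne j' hj') k (mem_Ico_lt ha hk) v (Finset.mem_range.1 hv) hkv

/-- The generating sets are pairwise incomparable: those of different runs are disjoint and
nonempty, and inside a run they are images of intervals of equal length. -/
theorem mem_facets_iff (hl : 0 < l) (hm : 0 < m) {D : SimplicialComplex V}
    (hx : ∀ j, Set.InjOn (x j) (Finset.range ((s j - 1) * l + m)))
    (hdis : ∀ j j', j ≠ j' → ∀ k < (s j - 1) * l + m, ∀ k' < (s j' - 1) * l + m,
      x j k ≠ x j' k')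
    (hD : ∀ G, G ∈ D.faces ↔
      ∃ j, ∃ a < s j, G ⊆ (Finset.Ico (a * l) (a * l + m)).image (x j)) (F : Finset V) :
    F ∈ D.facets ↔ ∃ j, ∃ a < s j, F = (Finset.Ico (a * l) (a * l + m)).image (x j) := by
  constructor
  · rintro ⟨hF, hmax⟩
    obtain ⟨j, a, ha, hFa⟩ := (hD F).1 hF
    exact ⟨j, a, ha, le_antisymm hFa (hmax ((hD _).2 ⟨j, a, ha, subset_rfl⟩) hFa)⟩
  · rintro ⟨j, a, ha, rfl⟩
    refine ⟨(hD _).2 ⟨j, a, ha, subset_rfl⟩, fun G hG hle => ?_⟩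
    obtain ⟨j', a', ha', hGa'⟩ := (hD G).1 hG
    have hsub := Finset.Subset.trans hle hGa'
    have hmem : ∀ k ∈ Finset.Ico (a * l) (a * l + m),
        ∃ k' ∈ Finset.Ico (a' * l) (a' * l + m), x j' k' = x j k := fun k hk =>
      Finset.mem_image.1 (hsub (Finset.mem_image_of_mem _ hk))
    have hjj : j = j' := by
      by_contra hne
      obtain ⟨k', hk', h⟩ := hmem (a * l) (Finset.mem_Ico.2 (by omega))
      exact hdis j j' hne (a * l) (mem_Ico_lt ha (Finset.mem_Ico.2 (by omega))) k'
        (mem_Ico_lt ha' hk') h.symm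
    subst hjj
    have hmem' : ∀ k ∈ Finset.Ico (a * l) (a * l + m),
        k ∈ Finset.Ico (a' * l) (a' * l + m) := fun k hk => by
      obtain ⟨k', hk', h⟩ := hmem k hk
      rwa [← hx j (by simpa using mem_Ico_lt ha' hk') (by simpa using mem_Ico_lt ha hk) h]
    -- Both endpoints of one interval lie in the other, and the lengths agree, so the intervals
    -- coincide.
    have h₁ := Finset.mem_Ico.1 (hmem' (a * l) (Finset.mem_Ico.2 (by omega)))
    have h₂ := Finset.mem_Ico.1 (hmem' (a * l + m - 1) (Finset.mem_Ico.2 (by omega)))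
    have haa : a * l = a' * l := by omega
    rw [Nat.eq_of_mul_eq_mul_right hl haa]
    exact hGa'

theorem homologyConcentrated_complement [Fintype ι] (hl : 0 < l) (hlm : l ≤ m)
    (hs : ∀ j, 1 ≤ s j) (hc : ∀ j, Collapses (fun v i => i * l ≤ v ∧ v < i * l + m)
      (Finset.range ((s j - 1) * l + m)) (Set.Iio (s j)) (e j)) {D : SimplicialComplex V}
    (hD : D.IsDisjointUnionOfRuns m l s) {n : ℕ} (hn : ∑ j, e j = n + 1) :
    HomologyConcentrated K (D.complement D.vertexSet) n := by
  classical
  obtain ⟨R, hR, hRdis, hDR⟩ := hD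
  choose x hx hxR using fun j => (hR j).exists_labelling hl hlm (hs j)
  have hvert : ∀ j v, v ∈ (R j).vertexSet ↔ ∃ k < (s j - 1) * l + m, x j k = v := by
    intro j v
    have : v ∈ (R j).vertexSet ↔
        ∃ a < s j, {v} ⊆ (Finset.Ico (a * l) (a * l + m)).image (x j) := hxR j {v}
    rw [this]
    constructor
    · rintro ⟨a, ha, hv⟩
      obtain ⟨k, hk, hkv⟩ := Finset.mem_image.1 (Finset.singleton_subset_iff.1 hv)
      exact ⟨k, mem_Ico_lt ha hk, hkv⟩
    · rintro ⟨k, hk, rfl⟩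
      obtain ⟨a, ha, hka⟩ := exists_mem_Ico hl hlm (hs j) hk
      exact ⟨a, ha, Finset.singleton_subset_iff.2 (Finset.mem_image_of_mem _ hka)⟩
  have hdis : ∀ j j', j ≠ j' → ∀ k < (s j - 1) * l + m, ∀ k' < (s j' - 1) * l + m,
      x j k ≠ x j' k' := fun j j' hne k hk k' hk' h =>
    Set.disjoint_left.1 (hRdis hne) ((hvert j _).2 ⟨k, hk, rfl⟩) ((hvert j' _).2 ⟨k', hk', h.symm⟩)
  have hDf : ∀ G, G ∈ D.faces ↔
      ∃ j, ∃ a < s j, G ⊆ (Finset.Ico (a * l) (a * l + m)).image (x j) := fun G => by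
    rw [hDR, Set.mem_iUnion]
    exact exists_congr fun j => hxR j G
  have hDv : ∀ v, v ∈ D.vertexSet ↔ v ∈ Finset.univ.biUnion fun j =>
      (Finset.range ((s j - 1) * l + m)).image (x j) := fun v => by
    have : v ∈ D.vertexSet ↔ {v} ∈ ⋃ j, (R j).faces := by rw [← hDR]; rfl
    rw [this, Set.mem_iUnion, Finset.mem_biUnion]
    refine exists_congr fun j => ?_
    have hj : {v} ∈ (R j).faces ↔ ∃ k < (s j - 1) * l + m, x j k = v := hvert j v
    simpa using hj
  have h := transversalConcentrated_biUnion (K := K) hx hdis hc Finset.univ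
  rw [hn] at h
  convert h.2 using 1
  ext G
  constructor
  · rintro ⟨_, ⟨F, hF, rfl⟩, hG⟩
    obtain ⟨j, a, ha, rfl⟩ := (mem_facets_iff hl (by omega) hx hdis hDf F).1 hF
    exact ⟨fun v hv => (hDv v).1 (hG hv).1, _, ⟨j, Finset.mem_univ j, a, ha, rfl⟩,
      Finset.disjoint_left.2 fun v hv hvF => (hG hv).2 hvF⟩
  · rintro ⟨hGW, F, ⟨j, -, a, ha, rfl⟩, hGF⟩
    exact ⟨_, ⟨_, (mem_facets_iff hl (by omega) hx hdis hDf _).2 ⟨j, a, ha, rfl⟩, rfl⟩,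
      fun v hv => ⟨(hDv v).2 (hGW hv), Finset.disjoint_left.1 hGF hv⟩⟩

end DisjointUnion

end SimplicialComplex

end PathComplexes

/-! ### Counting forced choices over all runs -/

theorem proposition4p4 {K : Type*} [Field K] {V : Type*} [LinearOrder V]
    (l m s t : ℕ) (hm : m = t * l + s) (hs : s < l) (ht : 2 ≤ t)
    (α β : ℕ) (hαβ : 0 < α + β) (p : Fin α → ℕ) (q : Fin β → ℕ)
    (Γ : PathComplexes.SimplicialComplex V)
    (hΓ : Γ.IsDisjointUnionOfRuns m l
      (Sum.elim (fun a => p a * (t + 1) + 1) (fun b => q b * (t + 1) + 2)))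
    (i : ℤ) :
    (i = 2 * ((∑ a, (p a : ℤ)) + ∑ b, (q b : ℤ)) + 2 * (β : ℤ) + (α : ℤ) - 2 →
      Nonempty ((Γ.complement Γ.vertexSet).ReducedHomology K i ≃ₗ[K] K)) ∧
    (i ≠ 2 * ((∑ a, (p a : ℤ)) + ∑ b, (q b : ℤ)) + 2 * (β : ℤ) + (α : ℤ) - 2 →
      Subsingleton ((Γ.complement Γ.vertexSet).ReducedHomology K i)) := by
  have hl : 0 < l := by omega
  have hlm : l ≤ m := by
    have := Nat.mul_le_mul_right l (show 1 ≤ t by omega)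
    omega
  have hsum : ∑ j, Sum.elim (fun a => 2 * p a + 1) (fun b => 2 * q b + 2) j =
      2 * ∑ a, p a + α + (2 * ∑ b, q b + 2 * β) := by
    simp [Fintype.sum_sum_type, Finset.sum_add_distrib, ← Finset.mul_sum, mul_comm β]
  have h := PathComplexes.SimplicialComplex.homologyConcentrated_complement (K := K)
    (e := Sum.elim (fun a => 2 * p a + 1) (fun b => 2 * q b + 2)) hl hlm
    (by rintro (a | b) <;> simp) ?_ hΓ
    -- The generating cycle has faces with $N-1$ elements, that is, of dimension $N-2$; the natural
    -- subtraction is exact because $\alpha+\beta>0$.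
    (n := 2 * ∑ a, p a + α + (2 * ∑ b, q b + 2 * β) - 1) (by omega)
  · have hcast : ((2 * ∑ a, p a + α + (2 * ∑ b, q b + 2 * β) - 1 : ℕ) : ℤ) =
        2 * ((∑ a, (p a : ℤ)) + ∑ b, (q b : ℤ)) + 2 * (β : ℤ) + (α : ℤ) - 1 := by
      rw [Nat.cast_sub (by omega)]
      push_cast
      ring
    exact ⟨fun hi => h.nonempty_equiv (by rw [hcast, hi]; ring),
      fun hi => h.subsingleton (by rw [hcast]; omega)⟩
  · have ht' : 1 ≤ t := by omega
    rintro (a | b)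
    · exact .run_of_range ht' hm hs (by simp)
        (by simpa using PathComplexes.SimplicialComplex.Collapses.range_mul_add_one ht' (p a))
    · refine .run_of_range ht' hm hs (by simp) ?_
      have h := PathComplexes.SimplicialComplex.Collapses.range_mul_add_two ht' (q b)
      rw [add_right_comm] at h
      exact h
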